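/- Let $A$ be a finite set, let $n \ge 0$, and let $t\colon A^n\to A$ be an idempotent operation, i.e. $t(x,\dots,x)=x$ for all $x\in A$. For $i\in\{0,\dots,n-1\}$, let $P(t,i)$ be the digraph on $A$ with an edge $x_i\to t(x_0,\dots,x_{n-1})$ for every choice of $x_0,\dots,x_{n-1}\in A$, and let $\overline{P(t,i)}$ be its transitive closure. Assume that for every $i\in\{0,\dots,n-1\}$ and all $u,v\in A$ there is $w\in A$ such that $u\to w$ and $v\to w$ are edges of $\overline{P(t,i)}$. Let $G$ be a digraph with vertex set $A$ such that (a) $G$ is strongly connected: for any vertices $u,v$ there is a directed walk (of length $\ge 0$) from $u$ to $v$; (b) $G$ is compatible with $t$: if $u_j\to v_j$ are edges of $G$ for $j=0,\dots,n-1$, then $t(u_0,\dots,u_{n-1})\to t(v_0,\dots,v_{n-1})$ is an edge of $G$; (c) $G$ has algebraic length $1$: there is no digraph homomorphism from $G$ to a directed cycle of length greater than one. Then $G$ has a loop, i.e. an edge $a\to a$ for some $a\in A$. -/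

import Mathlib

namespace LoopLemma

variable {A : Type*} {n : ℕ}

/-- An `n`-ary operation is idempotent if `t(x, …, x) = x` for all `x`. -/
def IsIdempotentOp (t : (Fin n → A) → A) : Prop :=
  ∀ x : A, t (fun _ => x) = x

/-- A digraph on `A` is compatible with `t` if applying `t` coordinatewise to edges
yields an edge. -/
def Compatible (G : Digraph A) (t : (Fin n → A) → A) : Prop :=
  ∀ u v : Fin n → A, (∀ j, G.Adj (u j) (v j)) → G.Adj (t u) (t v)

/-- Any two vertices are joined by a directed walk (of length `≥ 0`). -/
def StronglyConnected (G : Digraph A) : Prop :=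
  ∀ u v : A, Relation.ReflTransGen G.Adj u v

/-- The directed cycle of length `m` (for `m ≥ 1`). -/
def directedCycle (m : ℕ) : Digraph (ZMod m) where
  Adj a b := b = a + 1

/-- Algebraic length 1: there is no digraph homomorphism to a directed cycle of length
greater than one. -/
def AlgebraicLengthOne (G : Digraph A) : Prop :=
  ∀ m : ℕ, 1 < m → IsEmpty (G.Adj →r (directedCycle m).Adj)

/-- The digraph `P(t, i)` with edges `x i → t(x)` for all tuples `x`. -/
def coordDigraph (t : (Fin n → A) → A) (i : Fin n) : Digraph A where
  Adj u v := ∃ x : Fin n → A, x i = u ∧ t x = v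

/-- The transitive closure of a digraph. -/
def transClosure (G : Digraph A) : Digraph A where
  Adj := Relation.TransGen G.Adj

/-- A digraph has a loop if some vertex has an edge to itself. -/
def HasLoop (G : Digraph A) : Prop :=
  ∃ a : A, G.Adj a a

end LoopLemma

namespace LoopLemma

/-! Strong connectivity and algebraic length one make `G` primitive: for some `m`, any two vertices
are joined by a walk of length `m` (`exists_primitive`). A high iterated composition of `t` has
coordinate relations large enough to share an edge with `G` at every coordinate (`exists_opPow`).

These two properties yield a loop by induction on the size of `A` (`exists_loop_of_local`). If a
proper subset inherits them for some idempotent compatible operation (`IsGood`), recurse. Otherwise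
the ideals generated by recurrent elements, being good, are everything, and a power of the operation
becomes transitive: one entry and the value can be prescribed freely (`exists_transitive`).

For a transitive operation, absorption shows that linked compatible relations have a common
neighbour (`exists_common_of_linked`). With two or more elements, walks confined to a class of a
suitable congruence are linked, so they trap a proper good subset (`false_of_trap`). Hence `A` is a
point, and its outgoing edge is the loop. -/

/-- `Walk R k u v`: there is an `R`-walk of length `k` from `u` to `v`. -/
def Walk {A : Type*} (R : A → A → Prop) : ℕ → A → A → Prop
  | 0, u, v => u = v
  | k + 1, u, v => ∃ w, R u w ∧ Walk R k w v

/-- A binary relation preserved by an operation. -/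
def Preserves {A ι : Type*} (t : (ι → A) → A) (R : A → A → Prop) : Prop :=
  ∀ u v : ι → A, (∀ j, R (u j) (v j)) → R (t u) (t v)

/-- `u` at coordinate `i` can be completed to a tuple with value `v`. -/
def CoordRel {A ι : Type*} (t : (ι → A) → A) (i : ι) (u v : A) : Prop :=
  ∃ x : ι → A, x i = u ∧ t x = v

/-! ### Walks of prescribed length. -/

section Walks

variable {A ι : Type*} {R R' : A → A → Prop}

theorem Walk.append {k l : ℕ} {u v w : A} (h : Walk R k u v) (h' : Walk R l v w) :
    Walk R (k + l) u w := by
  induction k generalizing u with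
  | zero => cases h; simpa using h'
  | succ k ih =>
    obtain ⟨x, hx, hxv⟩ := h
    rw [Nat.add_right_comm]
    exact ⟨x, hx, ih hxv⟩

theorem Walk.split {k l : ℕ} {u w : A} (h : Walk R (k + l) u w) :
    ∃ v, Walk R k u v ∧ Walk R l v w := by
  induction k generalizing u with
  | zero => exact ⟨u, rfl, by simpa using h⟩
  | succ k ih =>
    rw [Nat.add_right_comm] at h
    obtain ⟨x, hx, hxw⟩ := h
    obtain ⟨v, h1, h2⟩ := ih hxw
    exact ⟨v, ⟨x, hx, h1⟩, h2⟩

theorem walk_one {u v : A} : Walk R 1 u v ↔ R u v :=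
  ⟨fun ⟨_, h, e⟩ => e ▸ h, fun h => ⟨v, h, rfl⟩⟩

theorem Walk.mono (hR : ∀ u v, R u v → R' u v) {k : ℕ} {u v : A} (h : Walk R k u v) :
    Walk R' k u v := by
  induction k generalizing u with
  | zero => exact h
  | succ k ih => obtain ⟨x, hx, hxv⟩ := h; exact ⟨x, hR _ _ hx, ih hxv⟩

theorem Walk.reflTransGen {k : ℕ} {u v : A} (h : Walk R k u v) :
    Relation.ReflTransGen R u v := by
  induction k generalizing u with
  | zero => cases h; exact .refl
  | succ k ih => obtain ⟨x, hx, hxv⟩ := h; exact .head hx (ih hxv)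

theorem exists_walk_of_reflTransGen {u v : A} (h : Relation.ReflTransGen R u v) :
    ∃ k, Walk R k u v := by
  induction h with
  | refl => exact ⟨0, rfl⟩
  | tail _ hxy ih => obtain ⟨k, hk⟩ := ih; exact ⟨k + 1, hk.append (walk_one.2 hxy)⟩

theorem Walk.of_refl (hR : ∀ u, R u u) (k : ℕ) (u : A) : Walk R k u u := by
  induction k with
  | zero => exact rfl
  | succ k ih => exact ⟨u, hR u, ih⟩

theorem Walk.extend (hR : ∀ u, R u u) {k l : ℕ} (hkl : k ≤ l) {u v : A} (h : Walk R k u v) :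
    Walk R l u v := by
  obtain ⟨m, rfl⟩ := Nat.exists_eq_add_of_le hkl
  exact h.append (.of_refl hR m v)

theorem Walk.mul {k : ℕ} {u : A} (h : Walk R k u u) (m : ℕ) : Walk R (m * k) u u := by
  induction m with
  | zero => simp [Walk]
  | succ m ih => rw [Nat.succ_mul]; exact ih.append h

theorem Walk.swap {k : ℕ} {u v : A} (h : Walk R k u v) : Walk (Function.swap R) k v u := by
  induction k generalizing u with
  | zero => exact Eq.symm h
  | succ k ih => obtain ⟨x, hx, hxv⟩ := h; exact (ih hxv).append (walk_one.2 hx)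

theorem exists_walk_of_total (hR : ∀ u, ∃ v, R u v) (k : ℕ) (u : A) : ∃ v, Walk R k u v := by
  induction k generalizing u with
  | zero => exact ⟨u, rfl⟩
  | succ k ih =>
    obtain ⟨w, hw⟩ := hR u
    obtain ⟨v, hv⟩ := ih w
    exact ⟨v, w, hw, hv⟩

/-- Walks in the coordinates combine to a walk of values. -/
theorem Walk.combine {t : (ι → A) → A} {S : ι → A → A → Prop}
    (ht : ∀ x y : ι → A, (∀ j, S j (x j) (y j)) → R (t x) (t y)) {k : ℕ} {u v : ι → A}
    (h : ∀ j, Walk (S j) k (u j) (v j)) : Walk R k (t u) (t v) := by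
  induction k generalizing u with
  | zero => exact congrArg t (funext h)
  | succ k ih =>
    choose w hw hwv using h
    exact ⟨t w, ht _ _ hw, ih hwv⟩

theorem Preserves.walk {t : (ι → A) → A} (ht : Preserves t R) (k : ℕ) :
    Preserves t (Walk R k) := fun _ _ h => Walk.combine ht h

/-- A walk starting in a set closed under steps stays in it. -/
theorem Walk.restrict {S : Set A} (hS : ∀ u v, u ∈ S → R u v → v ∈ S)
    {k : ℕ} {u v : A} (hu : u ∈ S) (h : Walk R k u v) :
    Walk (fun x y => R x y ∧ x ∈ S ∧ y ∈ S) k u v := by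
  induction k generalizing u with
  | zero => exact h
  | succ k ih =>
    obtain ⟨x, hx, hxv⟩ := h
    exact ⟨x, ⟨hx, hu, hS _ _ hu hx⟩, ih (hS _ _ hu hx) hxv⟩

theorem exists_uniform_walk [Finite A] (hR : ∀ u, R u u) :
    ∃ r, ∀ k, r ≤ k → ∀ u v, Relation.ReflTransGen R u v → Walk R k u v := by
  have : ∀ᶠ k in Filter.atTop, ∀ u v, Relation.ReflTransGen R u v → Walk R k u v := by
    refine Filter.eventually_all.2 fun u => Filter.eventually_all.2 fun v => ?_
    by_cases h : Relation.ReflTransGen R u v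
    · obtain ⟨k, hk⟩ := exists_walk_of_reflTransGen h
      filter_upwards [Filter.eventually_ge_atTop k] with l hl _ using hk.extend hR hl
    · exact Filter.Eventually.of_forall fun _ h' => absurd h' h
  obtain ⟨r, hr⟩ := Filter.eventually_atTop.1 this
  exact ⟨r, hr⟩

theorem Preserves.reflTransGen [Finite ι] {t : (ι → A) → A} (ht : Preserves t R)
    (hR : ∀ u, R u u) : Preserves t (Relation.ReflTransGen R) := by
  intro u v h
  choose k hk using fun j => exists_walk_of_reflTransGen (h j)
  obtain ⟨m, hm⟩ := (Set.finite_range k).bddAbove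
  exact (ht.walk m u v fun j => (hk j).extend hR (hm ⟨j, rfl⟩)).reflTransGen

/-- If all walks of one positive length exist, then all longer ones do. -/
theorem walk_of_le {m : ℕ} (hm : 1 ≤ m) (h : ∀ u v, Walk R m u v) {k : ℕ} (hk : m ≤ k) (u v : A) :
    Walk R k u v := by
  obtain ⟨l, rfl⟩ := Nat.exists_eq_add_of_le' hk
  have htot : ∀ u, ∃ v, R u v := fun u => by
    obtain ⟨m, rfl⟩ := Nat.exists_eq_add_of_le' hm
    obtain ⟨w, hw, -⟩ := h u u
    exact ⟨w, hw⟩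
  obtain ⟨w, hw⟩ := exists_walk_of_total htot l u
  exact hw.append (h w v)

theorem exists_out {m : ℕ} (hm : 1 ≤ m) (h : ∀ u v, Walk R m u v) (u : A) : ∃ v, R u v := by
  obtain ⟨m, rfl⟩ := Nat.exists_eq_add_of_le' hm
  obtain ⟨w, hw, -⟩ := h u u
  exact ⟨w, hw⟩

theorem exists_in {m : ℕ} (hm : 1 ≤ m) (h : ∀ u v, Walk R m u v) (v : A) : ∃ u, R u v := by
  obtain ⟨m, rfl⟩ := Nat.exists_eq_add_of_le' hm
  obtain ⟨w, -, hw⟩ := Walk.split (h v v)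
  exact ⟨w, walk_one.1 hw⟩

end Walks

/-! ### Iterated compositions of the operation. -/

section Powers

variable {A ι : Type*}

/-- The iterated star composition of `t` with itself; its coordinates are words. -/
def opPow (t : (ι → A) → A) : (k : ℕ) → ((Fin k → ι) → A) → A
  | 0, z => z Fin.elim0
  | k + 1, z => t fun i => opPow t k fun w => z (Fin.cons i w)

variable {t : (ι → A) → A}

theorem opPow_idem (ht : ∀ x, t (fun _ => x) = x) (k : ℕ) (x : A) :
    opPow t k (fun _ => x) = x := by
  induction k with
  | zero => rfl
  | succ k ih => simp only [opPow, ih, ht]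

theorem opPow_preserves {R : A → A → Prop} (ht : Preserves t R) (k : ℕ) :
    Preserves (opPow t k) R := by
  induction k with
  | zero => exact fun u v h => h _
  | succ k ih => exact fun u v h => ht _ _ fun i => ih _ _ fun w => h _

theorem coordRel_refl (ht : ∀ x, t (fun _ => x) = x) (i : ι) (u : A) : CoordRel t i u u :=
  ⟨fun _ => u, rfl, ht u⟩

/-- Only the subtree at `w 0` carries `x`; the others are constant, so idempotence lets them return
any desired argument of the outer `t`. -/
theorem coordRel_opPow_succ (ht : ∀ x, t (fun _ => x) = x) {k : ℕ} {w : Fin (k + 1) → ι}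
    {u u' v : A} (h : CoordRel (opPow t k) (Fin.tail w) u u') (h' : CoordRel t (w 0) u' v) :
    CoordRel (opPow t (k + 1)) w u v := by
  classical
  obtain ⟨x, hx, rfl⟩ := h
  obtain ⟨y, hy, rfl⟩ := h'
  refine ⟨fun w' => if w' 0 = w 0 then x (Fin.tail w') else y (w' 0), by simpa using hx, ?_⟩
  simp only [opPow, Fin.cons_zero, Fin.tail_cons]
  congr 1
  funext i
  split_ifs with hi
  · rw [hi, hy]
  · exact opPow_idem ht k _

/-- Each occurrence of `i` in `w` can perform one step of the walk; the remaining letters stay put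
by idempotence. -/
theorem coordRel_opPow_of_walk [DecidableEq ι] (ht : ∀ x, t (fun _ => x) = x) {i : ι} {k : ℕ}
    (w : Fin k → ι) {r : ℕ} (hr : r ≤ ∑ s, if w s = i then 1 else 0) {u v : A}
    (h : Walk (CoordRel t i) r u v) : CoordRel (opPow t k) w u v := by
  induction k generalizing r v with
  | zero =>
    simp only [Finset.univ_eq_empty, Finset.sum_empty, Nat.le_zero] at hr
    subst hr
    cases h
    exact coordRel_refl (opPow_idem ht 0) w u
  | succ k ih =>
    rw [Fin.sum_univ_succ] at hr
    by_cases hi : w 0 = i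
    · rcases r with _ | r
      · cases h
        exact coordRel_refl (opPow_idem ht _) w u
      · obtain ⟨x, hx, hxv⟩ := Walk.split h
        refine coordRel_opPow_succ ht (ih (Fin.tail w) ?_ hx) (hi ▸ walk_one.1 hxv)
        simp only [hi, if_true] at hr
        change r ≤ ∑ s : Fin k, if w s.succ = i then 1 else 0
        omega
    · simp only [hi, if_false, zero_add] at hr
      exact coordRel_opPow_succ ht (ih (Fin.tail w) hr h) (coordRel_refl ht _ _)

theorem reflTransGen_of_coordRel_opPow {k : ℕ} {i : ι} {u v : A}
    (h : CoordRel (opPow t k) (fun _ => i) u v) : Relation.ReflTransGen (CoordRel t i) u v := by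
  induction k generalizing v with
  | zero =>
    obtain ⟨x, rfl, rfl⟩ := h
    rw [Subsingleton.elim (fun _ : Fin 0 => i) Fin.elim0]
    exact .refl
  | succ k ih =>
    obtain ⟨x, rfl, rfl⟩ := h
    refine .tail (ih ⟨fun w => x (Fin.cons i w), ?_, rfl⟩) ⟨_, rfl, rfl⟩
    refine congrArg x (funext fun s => ?_)
    refine Fin.cases ?_ (fun _ => ?_) s <;> simp

/-- A high enough power has every coordinate relation above the transitive closure of some
coordinate relation of the operation. -/
theorem exists_opPow [Finite A] [Finite ι] (ht : ∀ x, t (fun _ => x) = x) :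
    ∃ k, (∀ w : Fin k → ι, ∃ i, ∀ u v, Relation.ReflTransGen (CoordRel t i) u v →
        CoordRel (opPow t k) w u v) ∧
      ∀ i u v, Relation.ReflTransGen (CoordRel t i) u v →
        CoordRel (opPow t k) (fun _ => i) u v := by
  classical
  cases nonempty_fintype ι
  choose r hr using fun i => exists_uniform_walk (coordRel_refl ht i)
  set N := ∑ i, r i with hN
  have hrN : ∀ i, r i ≤ N := fun i => Finset.single_le_sum (fun _ _ => Nat.zero_le _) (Finset.mem_univ i)
  -- Exceeding `card ι * N` forces some letter to occur more than `N` times; length at least `N`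
  -- serves the constant words.
  refine ⟨Fintype.card ι * N + N + 1, fun w => ?_, fun i u v h => ?_⟩
  · have hsum : ∑ i, ∑ s, (if w s = i then 1 else 0) = Fintype.card ι * N + N + 1 := by
      rw [Finset.sum_comm]; simp
    by_contra! hcon
    have hlt : ∀ i, ∑ s, (if w s = i then 1 else 0) ≤ N := fun i => by
      by_contra! hi
      obtain ⟨u, v, huv, hnot⟩ := hcon i
      exact hnot (coordRel_opPow_of_walk ht w hi.le (hr i N (hrN i) u v huv))
    have := Finset.sum_le_sum fun i (_ : i ∈ Finset.univ) => hlt i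
    rw [hsum] at this
    simp at this
  · exact coordRel_opPow_of_walk ht _ (r := N) (by simp; omega) (hr i N (hrN i) u v h)

end Powers
end LoopLemma
namespace LoopLemma

/-! ### Edges shared with coordinate relations, and the ideals they generate. -/

section Local

variable {A ι : Type*} {R : A → A → Prop} {t : (ι → A) → A}

/-- A subuniverse `S` on which `R` is primitive and meets every coordinate relation. -/
structure IsGood (R : A → A → Prop) (t : (ι → A) → A) (S : Set A) : Prop where
  closed : ∀ x : ι → A, (∀ j, x j ∈ S) → t x ∈ S
  prim : ∃ m, 1 ≤ m ∧ ∀ u ∈ S, ∀ v ∈ S, Walk (fun x y => R x y ∧ x ∈ S ∧ y ∈ S) m u v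
  loc : ∀ i, ∃ x : ι → A, (∀ j, x j ∈ S) ∧ R (x i) (t x)

/-- No proper subset is good for any idempotent operation preserving `R`. -/
def NoGoodSubset (R : A → A → Prop) : Prop :=
  ∀ (ι : Type) [Finite ι] (t : (ι → A) → A), (∀ x, t (fun _ => x) = x) → Preserves t R →
    ∀ S, IsGood R t S → S = Set.univ

/-- If `R (x j) (t x)`, then replacing `x j` by `t x` while all other coordinates make a step
yields such a tuple again. -/
theorem drive (ht : Preserves t R) {j : ι} {R' : A → A → Prop} (hR' : ∀ u v, R' u v → R u v)
    {Inv : (ι → A) → Prop}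
    (hInv : ∀ x x', Inv x → R (x j) (t x) → x' j = t x → (∀ l, l ≠ j → R' (x l) (x' l)) → Inv x')
    {k : ℕ} {x z : ι → A} (hx : Inv x) (hl : R (x j) (t x))
    (hw : ∀ l, l ≠ j → Walk R' k (x l) (z l)) :
    ∃ x', Inv x' ∧ R (x' j) (t x') ∧ (∀ l, l ≠ j → x' l = z l) ∧
      Walk (fun u v => R u v ∧ CoordRel t j u v) k (x j) (x' j) := by
  classical
  induction k generalizing x with
  | zero => exact ⟨x, hx, hl, hw, rfl⟩
  | succ k ih =>
    have : Nonempty A := ⟨t x⟩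
    choose! w hw1 hw2 using hw
    set x' : ι → A := fun l => if l = j then t x else w l with hx'
    have hj : x' j = t x := by simp [hx']
    have hne : ∀ l, l ≠ j → x' l = w l := fun l hl => by simp [hx', hl]
    -- At `j` this is the edge `hl` itself, so `ht` gives an edge from `t x = x' j` to `t x'`: the
    -- property reproduces itself.
    have hstep : ∀ l, R (x l) (x' l) := fun l => by
      by_cases h : l = j
      · subst h; rwa [hj]
      · rw [hne l h]; exact hR' _ _ (hw1 l h)
    obtain ⟨y, h1, h2, h3, h4⟩ := ih (x := x')
      (hInv x x' hx hl hj fun l h => by rw [hne l h]; exact hw1 l h)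
      (by rw [hj]; exact ht _ _ hstep) (fun l h => by rw [hne l h]; exact hw2 l h)
    exact ⟨y, h1, h2, h3, x' j, ⟨hstep j, x, rfl, hj.symm⟩, h4⟩

theorem drive_one (ht : Preserves t R) {j : ι} {R' : A → A → Prop} (hR' : ∀ u v, R' u v → R u v)
    {x z : ι → A} (hl : R (x j) (t x)) (hw : ∀ l, l ≠ j → R' (x l) (z l)) :
    ∃ x', x' j = t x ∧ R (x' j) (t x') ∧ ∀ l, l ≠ j → x' l = z l := by
  classical
  have hj : (fun l => if l = j then t x else z l) j = t x := if_pos rfl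
  refine ⟨fun l => if l = j then t x else z l, hj, ?_, fun l h => if_neg h⟩
  rw [hj]
  refine ht _ _ fun l => ?_
  by_cases h : l = j
  · subst h; simpa using hl
  · simpa [h] using hR' _ _ (hw l h)

/-- Driving the other coordinates around closed walks of length `m` restores them, and only
coordinate `i` changes. Iteration must repeat a value, which closes a cycle in both relations. -/
theorem exists_recurrent [Finite A] (ht : Preserves t R) {m : ℕ}
    (hall : ∀ u v, Walk R m u v) {i : ι} {x : ι → A} (hx : R (x i) (t x)) :
    ∃ x', R (x' i) (t x') ∧ Relation.ReflTransGen (CoordRel t i) (x i) (x' i) ∧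
      ∃ c, m ≤ c ∧ Walk (fun u v => R u v ∧ CoordRel t i u v) c (x' i) (x' i) := by
  let St : Set A := {a | ∃ y : ι → A, y i = a ∧ (∀ l, l ≠ i → y l = x l) ∧ R a (t y)}
  have hstep : ∀ a : St, ∃ b : St, Walk (fun u v => R u v ∧ CoordRel t i u v) m a.1 b.1 := by
    rintro ⟨a, y, rfl, hyx, hy⟩
    obtain ⟨y', -, h2, h3, h4⟩ := drive ht (R' := R) (fun _ _ h => h) (Inv := fun _ => True)
      (fun _ _ _ _ _ _ => trivial) (x := y) (z := x) trivial hy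
      (fun l hl => by rw [hyx l hl]; exact hall _ _)
    exact ⟨⟨y' i, y', rfl, h3, h2⟩, h4⟩
  choose f hf using hstep
  have hit : ∀ (n : ℕ) (a : St),
      Walk (fun u v => R u v ∧ CoordRel t i u v) (n * m) a.1 (f^[n] a).1 := by
    intro n
    induction n with
    | zero => intro a; simp [Walk]
    | succ n ih =>
      intro a
      rw [Nat.succ_mul, Nat.add_comm, Function.iterate_succ_apply]
      exact (hf a).append (ih _)
  let a₀ : St := ⟨x i, x, rfl, fun _ _ => rfl, hx⟩
  obtain ⟨p, q, hpq, heq⟩ := Finite.exists_ne_map_eq_of_infinite fun n => f^[n] a₀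
  wlog hlt : p < q generalizing p q
  · exact this q p hpq.symm heq.symm (by omega)
  obtain ⟨d, rfl⟩ := Nat.exists_eq_add_of_lt hlt
  obtain ⟨y, hy, -, hR⟩ := (f^[p] a₀).2
  refine ⟨y, by rwa [hy], ?_, (d + 1) * m, Nat.le_mul_of_pos_left _ d.succ_pos, ?_⟩
  · rw [hy]
    exact ((hit p a₀).mono fun _ _ h => h.2).reflTransGen
  · rw [hy]
    have := hit (d + 1) (f^[p] a₀)
    rw [← Function.iterate_add_apply, (by omega : d + 1 + p = p + d + 1), ← heq] at this
    exact this

/-- The ideal generated by a recurrent element is good. -/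
theorem isGood_ideal (hid : ∀ x, t (fun _ => x) = x) (ht : Preserves t R) {m : ℕ} (hm : 1 ≤ m)
    (hall : ∀ u v, Walk R m u v) (hloc : ∀ i, ∃ x : ι → A, R (x i) (t x)) {i : ι} {x : ι → A}
    (hx : R (x i) (t x)) {c : ℕ} (hc : m ≤ c)
    (hw : Walk (fun u v => R u v ∧ CoordRel t i u v) c (x i) (x i)) :
    IsGood R t {v | Relation.ReflTransGen (CoordRel t i) (x i) v} := by
  set X := {v | Relation.ReflTransGen (CoordRel t i) (x i) v} with hX
  have hideal : ∀ y : ι → A, y i ∈ X → t y ∈ X := fun y hy =>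
    Relation.ReflTransGen.tail hy ⟨y, rfl, rfl⟩
  have haX : x i ∈ X := .refl
  let RX : A → A → Prop := fun u v => R u v ∧ u ∈ X ∧ v ∈ X
  have hcomb : ∀ y y' : ι → A, RX (y i) (y' i) → (∀ l, l ≠ i → R (y l) (y' l)) →
      RX (t y) (t y') := fun y y' h h' =>
    ⟨ht _ _ fun l => by
      by_cases hl : l = i
      · subst hl; exact h.1
      · exact h' l hl, hideal _ h.2.1, hideal _ h.2.2⟩
  -- Only coordinate `i` must walk inside `X`; since `c ≥ m`, the others can join any two vertices.
  have hcombW : ∀ y y' : ι → A, Walk RX c (y i) (y' i) → Walk RX c (t y) (t y') := by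
    intro y y' h
    refine Walk.combine (S := fun l => fun u v => R u v ∧ (l = i → RX u v)) ?_ ?_
    · exact fun y y' h => hcomb _ _ ((h i).2 rfl) fun l _ => (h l).1
    · intro l
      by_cases hl : l = i
      · subst hl; exact h.mono fun u v h => ⟨h.1, fun _ => h⟩
      · exact (walk_of_le hm hall hc _ _).mono fun u v h => ⟨h, fun h' => absurd h' hl⟩
  have haa : Walk RX c (x i) (x i) :=
    (hw.restrict (S := X) (fun u v hu h => Relation.ReflTransGen.tail hu h.2) haX).mono
      fun u v h => ⟨h.1.1, h.2⟩
  have hea : ∀ e ∈ X, Walk RX c e (x i) := by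
    intro e he
    induction he with
    | refl => exact haa
    | tail _ h ih =>
      obtain ⟨y, rfl, rfl⟩ := h
      have := hcombW y (fun _ => x i) ih
      rwa [hid] at this
  have hee : ∀ e ∈ X, ∀ e' ∈ X, Walk RX c e e' := by
    intro e he e' he'
    induction he' with
    | refl => exact hea e he
    | tail _ h ih =>
      obtain ⟨y, rfl, rfl⟩ := h
      have := hcombW (fun _ => e) y ih
      rwa [hid] at this
  refine ⟨fun y hy => hideal y (hy i), ⟨c, hm.trans hc, hee⟩, fun j => ?_⟩
  obtain ⟨b, hb⟩ : ∃ b, RX (x i) b := by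
    obtain ⟨c, rfl⟩ := Nat.exists_eq_add_of_le' (hm.trans hc)
    obtain ⟨b, hb, -⟩ := haa
    exact ⟨b, hb⟩
  by_cases hj : j = i
  · subst hj
    obtain ⟨y, h1, h2, h3, -⟩ := drive ht (R' := R) (j := j) (fun _ _ h => h)
      (Inv := fun y => y j ∈ X) (fun y y' hy _ h _ => by rw [h]; exact hideal y hy)
      (x := x) (z := fun _ => x j) haX hx (fun l _ => hall _ _)
    refine ⟨y, fun l => ?_, h2⟩
    by_cases hl : l = j
    · subst hl; exact h1
    · rw [h3 l hl]; exact haX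
  · obtain ⟨y, hy⟩ := hloc j
    obtain ⟨y, -, h2, h3, -⟩ := drive ht (R' := R) (j := j) (fun _ _ h => h)
      (Inv := fun _ => True) (fun _ _ _ _ _ _ => trivial)
      (x := y) (z := fun _ => x i) trivial hy (fun l _ => hall _ _)
    obtain ⟨y', h1', h2', h3'⟩ := drive_one ht (R' := R) (fun _ _ h => h) (z := fun _ => b) h2
      (fun l hl => by rw [h3 l hl]; exact hb.1)
    refine ⟨y', fun l => ?_, h2'⟩
    by_cases hl : l = j
    · subst hl
      rw [h1']
      exact hideal y (by rw [h3 i (Ne.symm hj)]; exact haX)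
    · rw [h3' l hl]; exact hb.2.2

end Local

/-! ### Transitivity when no proper subset is good. -/

section Minimal

variable {A : Type*} [Finite A] {R : A → A → Prop}

theorem reflTransGen_coordRel_of_local {ι : Type} [Finite ι] {t : (ι → A) → A}
    (hmin : NoGoodSubset R) (hid : ∀ x, t (fun _ => x) = x)
    (ht : Preserves t R) {m : ℕ} (hm : 1 ≤ m) (hall : ∀ u v, Walk R m u v)
    (hloc : ∀ i, ∃ x : ι → A, R (x i) (t x)) {i : ι} {x : ι → A} (hx : R (x i) (t x)) (v : A) :
    Relation.ReflTransGen (CoordRel t i) (x i) v := by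
  obtain ⟨y, hy, hxy, c, hc, hw⟩ := exists_recurrent ht hall hx
  have huniv := hmin ι t hid ht _ (isGood_ideal hid ht hm hall hloc hy hc hw)
  exact hxy.trans (by have := Set.mem_univ v; rw [← huniv] at this; exact this)

/-- If no proper subset is good, some power of `t` is transitive in every coordinate. -/
theorem exists_transitive {ι : Type} [Finite ι] {t : (ι → A) → A}
    (hmin : NoGoodSubset R) (hid : ∀ x, t (fun _ => x) = x)
    (ht : Preserves t R) {m : ℕ} (hm : 1 ≤ m) (hall : ∀ u v, Walk R m u v)
    (hloc : ∀ i, ∃ x : ι → A, R (x i) (t x)) :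
    ∃ k, ∀ (w : Fin k → ι) (a c : A), CoordRel (opPow t k) w a c := by
  obtain ⟨k, hk, hk'⟩ := exists_opPow hid
  refine ⟨k, fun w a c => ?_⟩
  have hE : ∀ i, ∃ a, ∀ v, Relation.ReflTransGen (CoordRel t i) a v := fun i => by
    obtain ⟨x, hx⟩ := hloc i
    exact ⟨x i, reflTransGen_coordRel_of_local hmin hid ht hm hall hloc hx⟩
  have hlocT : ∀ w : Fin k → ι, ∃ x, R (x w) (opPow t k x) := fun w => by
    obtain ⟨i, hi⟩ := hk w
    obtain ⟨a, ha⟩ := hE i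
    obtain ⟨y, hy⟩ := exists_out hm hall a
    obtain ⟨x, rfl, rfl⟩ := hi a y (ha y)
    exact ⟨x, hy⟩
  -- Generating everything passes along edges: the power has a tuple with entry `a` and value `b`,
  -- and driving it one step produces a shared edge starting at `b`.
  have hout : ∀ i a b, (∀ v, Relation.ReflTransGen (CoordRel t i) a v) → R a b →
      ∀ v, Relation.ReflTransGen (CoordRel t i) b v := by
    intro i a b ha hab v
    obtain ⟨x, rfl, rfl⟩ := hk' i a b (ha b)
    obtain ⟨z, hz⟩ := Classical.axiomOfChoice fun w => exists_out hm hall (x w)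
    obtain ⟨y, h1, h2, -⟩ := drive_one (opPow_preserves ht k) (R' := R) (fun _ _ h => h) hab
      (fun l _ => hz l)
    have := reflTransGen_coordRel_of_local hmin (opPow_idem hid k) (opPow_preserves ht k) hm hall
      hlocT h2 v
    rw [h1] at this
    exact Relation.reflTransGen_closed (fun _ _ h => reflTransGen_of_coordRel_opPow h) _ _ this
  obtain ⟨i, hi⟩ := hk w
  refine hi a c ?_
  obtain ⟨e, he⟩ := hE i
  have : ∀ b, Relation.ReflTransGen R e b → ∀ v, Relation.ReflTransGen (CoordRel t i) b v := by
    intro b hb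
    induction hb with
    | refl => exact he
    | tail _ h ih => exact hout i _ _ ih h
  exact this a (hall e a).reflTransGen c

end Minimal
end LoopLemma
namespace LoopLemma

/-! ### Absorption and linkedness for transitive operations. -/

section Transitive

variable {A : Type*} [Finite A] {R : A → A → Prop} {ι : Type} [Finite ι] {t : (ι → A) → A}

/-- If some vertex of a proper subuniverse `E` is reached from everywhere by walks inside `E` of one
length, then the vertices reachable from it inside `E` form a good set. -/
theorem false_of_trap (hmin : NoGoodSubset R) (hid : ∀ x, t (fun _ => x) = x)
    (ht : Preserves t R) (htr : ∀ i a c, CoordRel t i a c) {E : Set A} (hE : E ≠ Set.univ)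
    (hcl : ∀ x : ι → A, (∀ j, x j ∈ E) → t x ∈ E) (hout : ∀ a, ∃ e, R a e ∧ e ∈ E)
    {z : A} (hz : z ∈ E) {m : ℕ} (hw : ∀ a, Walk (fun u v => R u v ∧ v ∈ E) m a z) : False := by
  set RE : A → A → Prop := fun u v => R u v ∧ v ∈ E with hRE
  have hRE_pres : Preserves t RE := fun u v h => ⟨ht _ _ fun j => (h j).1, hcl _ fun j => (h j).2⟩
  have hlong : ∀ k, m ≤ k → ∀ a, Walk RE k a z := by
    intro k hk a
    obtain ⟨l, rfl⟩ := Nat.exists_eq_add_of_le' hk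
    obtain ⟨b, hb⟩ := exists_walk_of_total hout l a
    exact hb.append (hw b)
  set S : Set A := {v | Relation.ReflTransGen RE z v} with hS
  have hSE : S ⊆ E := by
    intro v hv
    rcases Relation.ReflTransGen.cases_tail hv with h | ⟨_, -, h⟩
    · rwa [h]
    · exact h.2
  have hSstep : ∀ u v, u ∈ S → RE u v → v ∈ S := fun u v hu h => Relation.ReflTransGen.tail hu h
  -- Padding with closed walks at `z` reaches all of `S` in one length; since `t` fixes the constant
  -- tuple `z`, this closes `S` under `t`.
  obtain ⟨M, hM⟩ : ∃ M, ∀ v ∈ S, Walk RE M z v := by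
    choose k hk using fun v : S => exists_walk_of_reflTransGen v.2
    obtain ⟨K, hK⟩ := (Set.finite_range k).bddAbove
    refine ⟨K + m, fun v hv => ?_⟩
    have hle : k ⟨v, hv⟩ ≤ K := hK ⟨_, rfl⟩
    have := (hlong (K + m - k ⟨v, hv⟩) (by omega) z).append (hk ⟨v, hv⟩)
    rwa [Nat.sub_add_cancel (by omega)] at this
  have hgood : IsGood R t S := by
    refine ⟨fun x hx => ?_, ⟨m + 1 + M, by omega, fun u hu v hv => ?_⟩, fun i => ?_⟩
    · have := hRE_pres.walk M (fun _ => z) x fun j => hM _ (hx j)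
      rw [hid] at this
      exact this.reflTransGen
    · exact (((hlong (m + 1) (by omega) u).append (hM v hv)).restrict hSstep hu).mono
        fun _ _ h => ⟨h.1.1, h.2⟩
    · obtain ⟨y, hzy⟩ := hout z
      have hyS : y ∈ S := .single hzy
      -- Transitivity supplies a shared edge at `z`. After a step into `E`, the other entries walk
      -- to `z` inside `E` while entry `i` stays in `S`.
      obtain ⟨x, rfl, rfl⟩ := htr i z y
      choose b hb using fun l => hout (x l)
      obtain ⟨x₁, h1, h1', h1''⟩ := drive_one ht (R' := RE) (fun _ _ h => h.1) hzy.1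
        (fun l _ => hb l)
      obtain ⟨x₂, ⟨h2, -⟩, h3, h4, -⟩ := drive ht (R' := RE) (j := i) (fun _ _ h => h.1)
        (Inv := fun y => y i ∈ S ∧ ∀ l, l ≠ i → y l ∈ E)
        (fun y y' hy hR hyi hl => ⟨hSstep _ _ hy.1 ⟨hyi ▸ hR, by
            rw [hyi]
            refine hcl y fun l => ?_
            by_cases hli : l = i
            · subst hli; exact hSE hy.1
            · exact hy.2 l hli⟩, fun l hli => (hl l hli).2⟩)
        (x := x₁) (z := fun _ => x i) (k := m)
        ⟨by rwa [h1], fun l hl => by rw [h1'' l hl]; exact (hb l).2⟩ h1' (fun l _ => hw _)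
      refine ⟨x₂, fun l => ?_, h3⟩
      by_cases hli : l = i
      · subst hli; exact h2
      · rw [h4 l hli]; exact .refl
  exact hE (Set.eq_univ_of_univ_subset ((hmin ι t hid ht S hgood) ▸ hSE))

/-- There is no proper nonempty set absorbing every coordinate of a transitive operation. -/
theorem eq_univ_of_absorbing (hmin : NoGoodSubset R) (hid : ∀ x, t (fun _ => x) = x)
    (ht : Preserves t R) {m : ℕ} (hm : 1 ≤ m) (hall : ∀ u v, Walk R m u v)
    (htr : ∀ i a c, CoordRel t i a c) {B : Set A} (hB : B.Nonempty)
    (habs : ∀ i, ∀ x : ι → A, (∀ l, l ≠ i → x l ∈ B) → t x ∈ B) : B = Set.univ := by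
  classical
  cases nonempty_fintype ι
  rcases isEmpty_or_nonempty ι with hι | ⟨⟨i₀⟩⟩
  · obtain ⟨b, hb⟩ := hB
    refine Set.eq_univ_of_forall fun a => ?_
    rwa [← hid a, Subsingleton.elim (fun _ : ι => a) (fun _ => b), hid b]
  by_contra hne
  have htot := exists_out hm hall
  have hex : ∃ s, {v | ∃ b ∈ B, Walk R s v b} = Set.univ := by
    obtain ⟨b, hb⟩ := hB
    exact ⟨m, Set.eq_univ_of_forall fun a => ⟨b, hb, hall a b⟩⟩
  -- `s + 1` is the least length at which every vertex has a walk into `B`, so `E` is proper yet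
  -- entered by an edge from every vertex.
  obtain ⟨s, hs, hs'⟩ : ∃ s, {v | ∃ b ∈ B, Walk R s v b} ≠ Set.univ ∧
      {v | ∃ b ∈ B, Walk R (s + 1) v b} = Set.univ := by
    have h0 : Nat.find hex ≠ 0 := fun h0 => by
      have := Nat.find_spec hex
      rw [h0] at this
      simp only [Walk, exists_eq_right', Set.ofPred_mem_eq] at this
      exact hne this
    obtain ⟨s, hs⟩ := Nat.exists_eq_succ_of_ne_zero h0
    refine ⟨s, Nat.find_min hex (by omega), ?_⟩
    have := Nat.find_spec hex
    rwa [hs] at this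
  set E : Set A := {v | ∃ b ∈ B, Walk R s v b} with hE
  have habsE : ∀ i, ∀ x : ι → A, (∀ l, l ≠ i → x l ∈ E) → t x ∈ E := by
    intro i x hx
    have : ∀ l, ∃ b, (l ≠ i → b ∈ B) ∧ Walk R s (x l) b := fun l => by
      by_cases hl : l = i
      · obtain ⟨b, hb⟩ := exists_walk_of_total htot s (x l)
        exact ⟨b, fun h => absurd hl h, hb⟩
      · obtain ⟨b, hb, hb'⟩ := hx l hl
        exact ⟨b, fun _ => hb, hb'⟩
    choose b hb hb' using this
    exact ⟨t b, habs i b hb, ht.walk s _ _ hb'⟩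
  have hout : ∀ a, ∃ e, R a e ∧ e ∈ E := fun a => by
    obtain ⟨b, hb, e, he, hw⟩ : a ∈ {v | ∃ b ∈ B, Walk R (s + 1) v b} := hs' ▸ Set.mem_univ a
    exact ⟨e, he, b, hb, hw⟩
  set RE : A → A → Prop := fun u v => R u v ∧ v ∈ E with hRE
  obtain ⟨e, he, M, hmM, hM⟩ : ∃ e ∈ E, ∃ M, m ≤ M ∧ Walk RE M e e := by
    choose g hg using hout
    have hit : ∀ n a, Walk RE n a (g^[n] a) := by
      intro n
      induction n with
      | zero => exact fun a => rfl
      | succ n ih => exact fun a => ⟨g a, hg a, ih (g a)⟩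
    obtain ⟨b, -⟩ := hB
    obtain ⟨p, q, hpq, heq⟩ := Finite.exists_ne_map_eq_of_infinite fun n => g^[n] (g b)
    wlog hlt : p < q generalizing p q
    · exact this q p hpq.symm heq.symm (by omega)
    obtain ⟨d, rfl⟩ := Nat.exists_eq_add_of_lt hlt
    have hcyc := hit (d + 1) (g^[p] (g b))
    rw [← Function.iterate_add_apply, (by omega : d + 1 + p = p + d + 1), ← heq] at hcyc
    refine ⟨g^[p] (g b), ?_, m * (d + 1), Nat.le_mul_of_pos_right _ d.succ_pos, hcyc.mul m⟩
    rw [← Function.iterate_succ_apply, Function.iterate_succ_apply']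
    exact (hg _).2
  -- Entries move to `e` one coordinate at a time; the moving one may leave `E`, since absorption
  -- needs only the others there.
  have key : ∀ s : Finset ι, ∃ k, ∀ a, ∃ f : ι → A, (∀ l ∈ s, f l = e) ∧ Walk RE k a (t f) := by
    intro s
    induction s using Finset.induction_on with
    | empty => exact ⟨0, fun a => ⟨fun _ => a, by simp, (hid a).symm⟩⟩
    | insert i s hi ih =>
      obtain ⟨k, hk⟩ := ih
      refine ⟨k + M, fun a => ?_⟩
      obtain ⟨f, hf, hw⟩ := hk a
      have : ∀ l, ∃ b, (l ∈ insert i s → b = e) ∧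
          Walk (fun u v => R u v ∧ (l ≠ i → v ∈ E)) M (f l) b := by
        intro l
        by_cases hl : l = i
        · exact ⟨e, fun _ => rfl, (walk_of_le hm hall hmM _ _).mono
            fun u v h => ⟨h, fun h' => absurd hl h'⟩⟩
        · by_cases hls : l ∈ s
          · rw [hf l hls]
            exact ⟨e, fun _ => rfl, hM.mono fun u v h => ⟨h.1, fun _ => h.2⟩⟩
          · obtain ⟨b, hb⟩ := exists_walk_of_total hout M (f l)
            refine ⟨b, fun h => ?_, hb.mono fun u v h => ⟨h.1, fun _ => h.2⟩⟩
            exact absurd (Finset.mem_insert.1 h) (by tauto)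
      choose f' hf' hw' using this
      refine ⟨f', hf', hw.append (Walk.combine ?_ hw')⟩
      exact fun x y h => ⟨ht _ _ fun l => (h l).1, habsE i y fun l => (h l).2⟩
  obtain ⟨k, hk⟩ := key Finset.univ
  refine false_of_trap hmin hid ht htr hs (fun x hx => habsE i₀ x fun l _ => hx l) hout he
    (m := k) fun a => ?_
  obtain ⟨f, hf, hw⟩ := hk a
  rwa [show f = fun _ => e from funext fun l => hf l (Finset.mem_univ l), hid] at hw

/-- A compatible left total relation with a full left neighbourhood is full. -/
theorem full_of_center (hmin : NoGoodSubset R) (hid : ∀ x, t (fun _ => x) = x)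
    (ht : Preserves t R) {m : ℕ} (hm : 1 ≤ m) (hall : ∀ u v, Walk R m u v)
    (htr : ∀ i a c, CoordRel t i a c) {Q : A → A → Prop} (hQ : Preserves t Q)
    (htot : ∀ a, ∃ b, Q a b) {c : A} (hc : ∀ b, Q c b) (a b : A) : Q a b := by
  have huniv : {a | ∀ b, Q a b} = Set.univ := by
    -- The vertices with full neighbourhood absorb: transitivity completes a neighbour of the
    -- exceptional entry to a tuple with value `b`.
    refine eq_univ_of_absorbing hmin hid ht hm hall htr ⟨c, hc⟩ fun i x hx b => ?_
    obtain ⟨e, he⟩ := htot (x i)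
    obtain ⟨y, rfl, rfl⟩ := htr i e b
    refine hQ _ _ fun l => ?_
    by_cases hl : l = i
    · subst hl; exact he
    · exact hx l hl _
  exact (huniv ▸ Set.mem_univ a : a ∈ {a | ∀ b, Q a b}) b

/-- A Helly-type induction: any `c ∈ F₂` is a center of the relation of having a common neighbour
together with `F₂`, so `full_of_center` adds two points at once. -/
theorem exists_common_of_pairs [Nonempty A] (hmin : NoGoodSubset R)
    (hid : ∀ x, t (fun _ => x) = x) (ht : Preserves t R) {m : ℕ} (hm : 1 ≤ m)
    (hall : ∀ u v, Walk R m u v) (htr : ∀ i a c, CoordRel t i a c) {N : A → A → Prop}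
    (hN : Preserves t N) (h2 : ∀ a a', ∃ z, N a z ∧ N a' z) : ∃ z, ∀ a, N a z := by
  classical
  cases nonempty_fintype A
  have key : ∀ n, ∀ F : Finset A, F.card ≤ n + 2 → ∃ z, ∀ a ∈ F, N a z := by
    intro n
    induction n with
    | zero =>
      intro F hF
      by_cases h0 : F.card < 2
      · obtain ⟨a, ha⟩ := Finset.card_le_one_iff_subset_singleton.1 (Nat.lt_succ_iff.1 h0)
        obtain ⟨z, hz, -⟩ := h2 a a
        exact ⟨z, fun b hb => by rwa [Finset.mem_singleton.1 (ha hb)]⟩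
      · obtain ⟨a, b, -, rfl⟩ := Finset.card_eq_two.1 (by omega : F.card = 2)
        obtain ⟨z, hz, hz'⟩ := h2 a b
        exact ⟨z, by simp [hz, hz']⟩
    | succ n ih =>
      intro F hF
      by_cases hlt : F.card ≤ n + 2
      · exact ih F hlt
      obtain ⟨a, F₁, ha, rfl, h1⟩ := Finset.card_eq_succ.1 (by omega : F.card = (n + 2) + 1)
      obtain ⟨b, F₂, hb, rfl, h2'⟩ := Finset.card_eq_succ.1 h1
      obtain ⟨c, hc⟩ := Finset.card_pos.1 (by omega : 0 < F₂.card)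
      let Q : A → A → Prop := fun x y => ∃ z, N x z ∧ N y z ∧ ∀ d ∈ F₂, N d z
      have hQ : Preserves t Q := by
        intro u v h
        choose z h1 h2 h3 using h
        refine ⟨t z, hN _ _ h1, hN _ _ h2, fun d hd => ?_⟩
        have := hN (fun _ => d) z fun j => h3 j d hd
        rwa [hid] at this
      have hins : ∀ x, ∃ z, N x z ∧ ∀ d ∈ F₂, N d z := fun x => by
        obtain ⟨z, hz⟩ := ih (insert x F₂) ((Finset.card_insert_le _ _).trans (by omega))
        exact ⟨z, hz x (Finset.mem_insert_self _ _), fun d hd => hz d (Finset.mem_insert_of_mem hd)⟩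
      obtain ⟨z, hza, hzb, hz⟩ := full_of_center hmin hid ht hm hall htr hQ
        (fun x => (hins x).elim fun z hz => ⟨c, z, hz.1, hz.2 c hc, hz.2⟩)
        (c := c) (fun y => (hins y).elim fun z hz => ⟨z, hz.2 c hc, hz.1, hz.2⟩) a b
      refine ⟨z, fun d hd => ?_⟩
      rcases Finset.mem_insert.1 hd with rfl | hd
      · exact hza
      rcases Finset.mem_insert.1 hd with rfl | hd
      · exact hzb
      · exact hz d hd
  obtain ⟨z, hz⟩ := key (Finset.univ (α := A)).card Finset.univ (by omega)
  exact ⟨z, fun a => hz a (Finset.mem_univ a)⟩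

/-- A compatible linked relation has an element related to everything. -/
theorem exists_common_of_linked [Nonempty A] (hmin : NoGoodSubset R)
    (hid : ∀ x, t (fun _ => x) = x) (ht : Preserves t R) {m : ℕ} (hm : 1 ≤ m)
    (hall : ∀ u v, Walk R m u v) (htr : ∀ i a c, CoordRel t i a c) {N : A → A → Prop}
    (hN : Preserves t N) (htot : ∀ a, ∃ z, N a z)
    (hl : ∀ a a', Relation.ReflTransGen (fun a a' => ∃ z, N a z ∧ N a' z) a a') :
    ∃ z, ∀ a, N a z := by
  classical
  refine exists_common_of_pairs hmin hid ht hm hall htr hN ?_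
  set W : A → A → Prop := fun a a' => ∃ z, N a z ∧ N a' z with hW
  have hWrefl : ∀ a, W a a := fun a => (htot a).elim fun z hz => ⟨z, hz, hz⟩
  have hWpres : Preserves t W := fun u v h => by
    choose z h1 h2 using h
    exact ⟨t z, hN _ _ h1, hN _ _ h2⟩
  have hWsymm : ∀ k u v, Walk W k u v → Walk W k v u := fun k u v h =>
    h.swap.mono fun _ _ ⟨z, h1, h2⟩ => ⟨z, h2, h1⟩
  have hex : ∃ J, ∀ u v, Walk W J u v := by
    obtain ⟨r, hr⟩ := exists_uniform_walk hWrefl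
    exact ⟨r, fun u v => hr r le_rfl u v (hl u v)⟩
  by_cases hJ : Nat.find hex ≤ 1
  · exact fun u v => walk_one.1 ((Nat.find_spec hex u v).extend hWrefl hJ)
  · exfalso
    refine Nat.find_min hex (m := Nat.find hex - 1) (by omega) ?_
    -- The least full exponent is at least 2, hence at most `2 * J`; cutting walks in the middle
    -- gives common ends for pairs.
    set J := Nat.find hex - 1 with hJdef
    have hpair : ∀ a a', ∃ z, Walk W J a z ∧ Walk W J a' z := fun a a' => by
      obtain ⟨z, h1, h2⟩ := Walk.split (k := J) (l := J)
        ((Nat.find_spec hex a a').extend hWrefl (by omega))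
      exact ⟨z, h1, hWsymm _ _ _ h2⟩
    obtain ⟨z, hz⟩ := exists_common_of_pairs hmin hid ht hm hall htr (hWpres.walk J) hpair
    exact full_of_center hmin hid ht hm hall htr (hWpres.walk J)
      (fun a => ⟨a, .of_refl hWrefl J a⟩) fun b => hWsymm _ _ _ (hz b)

/-- A transitive operation on at least two elements always leaves a proper good subset. -/
theorem subsingleton_of_transitive (hmin : NoGoodSubset R) (hid : ∀ x, t (fun _ => x) = x)
    (ht : Preserves t R) {m : ℕ} (hm : 1 ≤ m) (hall : ∀ u v, Walk R m u v)
    (htr : ∀ i a c, CoordRel t i a c) : Subsingleton A := by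
  classical
  by_contra hns
  rw [not_subsingleton_iff_nontrivial] at hns
  cases nonempty_fintype ι
  have htot := exists_out hm hall
  let L : ℕ → A → A → Prop := fun j a a' => ∃ z, Walk R j a z ∧ Walk R j a' z
  have hLrefl : ∀ j a, L j a a := fun j a =>
    (exists_walk_of_total htot j a).elim fun z hz => ⟨z, hz, hz⟩
  have hLpres : ∀ j, Preserves t (L j) := fun j u v h => by
    choose z h1 h2 using h
    exact ⟨t z, ht.walk j _ _ h1, ht.walk j _ _ h2⟩
  have hLmono : ∀ j k, j ≤ k → ∀ a a', L j a a' → L k a a' := by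
    rintro j k hjk a a' ⟨z, h1, h2⟩
    obtain ⟨l, rfl⟩ := Nat.exists_eq_add_of_le hjk
    obtain ⟨y, hy⟩ := exists_walk_of_total htot l z
    exact ⟨y, h1.append hy, h2.append hy⟩
  -- At the last unlinked level `j`, the closure of `L j` is a proper congruence.
  obtain ⟨j, hj, hj'⟩ : ∃ j, (¬ ∀ a a', Relation.ReflTransGen (L j) a a') ∧
      ∀ a a', Relation.ReflTransGen (L (j + 1)) a a' := by
    have hex : ∃ j, ∀ a a', Relation.ReflTransGen (L j) a a' :=
      ⟨m, fun a a' => .single ⟨a, hall _ _, hall _ _⟩⟩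
    have h0 : Nat.find hex ≠ 0 := fun h0 => by
      obtain ⟨a, b, hab⟩ := exists_pair_ne A
      have := Nat.find_spec hex a b
      rw [h0] at this
      refine hab ?_
      clear hab
      induction this with
      | refl => rfl
      | tail _ h ih => obtain ⟨z, h1, h2⟩ := h; exact ih.trans (Eq.trans h1 (Eq.symm h2))
    obtain ⟨s, hs⟩ := Nat.exists_eq_succ_of_ne_zero h0
    refine ⟨s, Nat.find_min hex (by omega), ?_⟩
    have := Nat.find_spec hex
    rwa [hs] at this
  set θ : A → A → Prop := Relation.ReflTransGen (L j) with hθ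
  have hθpres : Preserves t θ := (hLpres j).reflTransGen (hLrefl j)
  have hθsymm : ∀ {a b}, θ a b → θ b a := fun h => by
    induction h with
    | refl => exact .refl
    | tail _ h ih => obtain ⟨z, h1, h2⟩ := h; exact .head ⟨z, h2, h1⟩ ih
  have hθtrans : ∀ {a b c}, θ a b → θ b c → θ a c := fun h h' => Relation.ReflTransGen.trans h h'
  have hcpres : Preserves t fun a b => ∃ e, R a e ∧ θ e b := fun u v h => by
    choose e h1 h2 using h
    exact ⟨t e, ht _ _ h1, hθpres _ _ h2⟩
  -- Vertices related by `L (j + 1)` have out-neighbours in one `θ`-class, so `R` followed by `θ` is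
  -- linked; it turns out to be full.
  have hstep : ∀ a b, ∃ e, R a e ∧ θ e b := by
    obtain ⟨z, hz⟩ := exists_common_of_linked hmin hid ht hm hall htr hcpres
      (fun a => (htot a).elim fun b hb => ⟨b, b, hb, .refl⟩) (fun a a' => by
        refine Relation.ReflTransGen.mono ?_ _ _ (hj' a a')
        rintro a a' ⟨z, ⟨e, he, hez⟩, ⟨e', he', hez'⟩⟩
        exact ⟨e', ⟨e, he, .single ⟨z, hez, hez'⟩⟩, e', he', .refl⟩)
    intro a b
    exact full_of_center hmin hid ht hm hall htr (Q := fun b a => ∃ e, R a e ∧ θ e b)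
      (fun u v h => hcpres v u h)
      (fun b => (exists_in hm hall b).elim fun a ha => ⟨a, b, ha, .refl⟩) hz b a
  obtain ⟨v₀⟩ : Nonempty A := inferInstance
  set E : Set A := {e | θ e v₀} with hE
  have hEne : E ≠ Set.univ := fun h => hj fun a a' => by
    have ha : a ∈ E := h ▸ Set.mem_univ a
    have ha' : a' ∈ E := h ▸ Set.mem_univ a'
    exact hθtrans ha (hθsymm ha')
  have hEcl : ∀ x : ι → A, (∀ j, x j ∈ E) → t x ∈ E := fun x hx => by
    have := hθpres x (fun _ => v₀) hx
    rwa [hid] at this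
  set RE : A → A → Prop := fun u v => R u v ∧ v ∈ E with hRE
  have hout : ∀ a, ∃ e, RE a e := fun a => hstep a v₀
  have hREpres : Preserves t RE := fun u v h =>
    ⟨ht _ _ fun j => (h j).1, hEcl _ fun j => (h j).2⟩
  -- two walks with a common end can be moved into `E` by moving one coordinate along them
  have hmove : ∀ (i : ι) (k : ℕ), k ≤ j + 1 → ∀ (x x' : ι → A) (z : A), (∀ l, l ≠ i → x l = x' l) →
      Walk R k (x i) z → Walk R k (x' i) z →
      ∃ y, Walk RE k (t x) y ∧ Walk RE k (t x') y := by
    intro i k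
    induction k with
    | zero =>
      rintro - x x' z hx h1 h2
      have : x = x' := funext fun l => by
        by_cases hl : l = i
        · subst hl; exact Eq.trans h1 (Eq.symm h2)
        · exact hx l hl
      exact ⟨t x, rfl, by rw [this]; rfl⟩
    | succ k ih =>
      rintro hk x x' z hx ⟨w, hw, hwz⟩ ⟨w', hw', hwz'⟩
      have hww : θ w' w := .single (hLmono k j (by omega) _ _ ⟨z, hwz', hwz⟩)
      -- As `t y = v₀`, stepping the other entries into the classes of the entries of `y` puts both
      -- new values in `E`.
      obtain ⟨y, hyi, hy⟩ := htr i w v₀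
      choose b hb hby using fun l => hstep (x l) (y l)
      set x₁ : ι → A := fun l => if l = i then w else b l with hx₁
      set x₁' : ι → A := fun l => if l = i then w' else b l with hx₁'
      have hR : ∀ l, R (x l) (x₁ l) := fun l => by
        by_cases hl : l = i
        · subst hl; simpa [hx₁] using hw
        · simpa [hx₁, hl] using hb l
      have hR' : ∀ l, R (x' l) (x₁' l) := fun l => by
        by_cases hl : l = i
        · subst hl; simpa [hx₁'] using hw'
        · simpa [hx₁', hl, ← hx l hl] using hb l
      have hmem : t x₁ ∈ E := by
        have := hθpres x₁ y fun l => by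
          by_cases hl : l = i
          · subst hl; simp only [hx₁, if_true, hyi]; exact .refl
          · simpa [hx₁, hl] using hby l
        rwa [hy] at this
      have hmem' : t x₁' ∈ E := by
        have := hθpres x₁' y fun l => by
          by_cases hl : l = i
          · subst hl; simpa only [hx₁', if_true, hyi] using hww
          · simpa [hx₁', hl] using hby l
        rwa [hy] at this
      obtain ⟨y', h1, h2⟩ := ih (by omega) x₁ x₁' z (fun l hl => by simp [hx₁, hx₁', hl])
        (by simpa [hx₁] using hwz) (by simpa [hx₁'] using hwz')
      exact ⟨y', ⟨t x₁, ⟨ht _ _ hR, hmem⟩, h1⟩, ⟨t x₁', ⟨ht _ _ hR', hmem'⟩, h2⟩⟩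
  set N : A → A → Prop := Walk RE (j + 1) with hN
  have hlink : ∀ a a', Relation.ReflTransGen (fun a a' => ∃ z, N a z ∧ N a' z) a a' := by
    intro a a'
    have hone : ∀ (i : ι) (x : ι → A) (b b' : A),
        Relation.ReflTransGen (fun a a' => ∃ z, N a z ∧ N a' z)
          (t (Function.update x i b)) (t (Function.update x i b')) := by
      intro i x b b'
      refine Relation.ReflTransGen.lift (fun b => t (Function.update x i b)) ?_ _ _ (hj' b b')
      rintro b b' ⟨z, h1, h2⟩
      exact hmove i (j + 1) le_rfl _ _ z (fun l hl => by simp [hl]) (by simpa using h1)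
        (by simpa using h2)
    -- Changing the constant tuple `a` into `a'` one entry at a time links their values.
    have key : ∀ s : Finset ι, Relation.ReflTransGen (fun a a' => ∃ z, N a z ∧ N a' z)
        a (t (s.piecewise (fun _ => a') fun _ => a)) := by
      intro s
      induction s using Finset.induction_on with
      | empty => rw [Finset.piecewise_empty, hid]
      | insert i s hi ih =>
        have := hone i (s.piecewise (fun _ => a') fun _ => a) a a'
        rw [Finset.piecewise_insert]
        refine ih.trans ?_
        convert this using 2
        refine (Function.update_eq_self_iff.2 ?_).symm
        simp [hi]
    have := key Finset.univ
    rwa [Finset.piecewise_univ, hid] at this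
  obtain ⟨z, hz⟩ := exists_common_of_linked hmin hid ht hm hall htr (hREpres.walk (j + 1))
    (exists_walk_of_total hout (j + 1)) hlink
  have hzE : z ∈ E := by
    obtain ⟨w, -, hw⟩ := Walk.split (hz z)
    exact (walk_one.1 hw).2
  exact false_of_trap hmin hid ht htr hEne hEcl hout hzE hz

end Transitive
end LoopLemma
namespace LoopLemma

/-! ### The induction on `A`, primitivity, and the conclusion. -/

/-- An idempotent operation meeting a primitive compatible digraph in every coordinate relation
forces a loop. -/
theorem exists_loop_of_local {A : Type*} [Finite A] {R : A → A → Prop} {ι : Type} [Finite ι]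
    {t : (ι → A) → A} (hid : ∀ x, t (fun _ => x) = x) (ht : Preserves t R) [Nonempty A]
    {m : ℕ} (hm : 1 ≤ m) (hall : ∀ u v, Walk R m u v) (hloc : ∀ i, ∃ x : ι → A, R (x i) (t x)) :
    ∃ a, R a a := by
  induction hn : Nat.card A using Nat.strong_induction_on generalizing A ι m with
  | _ n ih =>
    by_contra hno
    have hmin : NoGoodSubset R := by
      intro κ _ s hs hsR S hS
      by_contra hne
      obtain ⟨p, hp, hpS⟩ := hS.prim
      have hSne : S.Nonempty := by
        rcases isEmpty_or_nonempty κ with hκ | ⟨⟨i⟩⟩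
        · exact ⟨_, hS.closed isEmptyElim fun j => isEmptyElim j⟩
        · obtain ⟨x, hx, -⟩ := hS.loc i
          exact ⟨x i, hx i⟩
      have : Nonempty S := hSne.to_subtype
      let s' : (κ → S) → S := fun x => ⟨s fun j => x j, hS.closed _ fun j => (x j).2⟩
      have hwalk : ∀ (k : ℕ) (u v : S),
          Walk (fun x y => R x y ∧ x ∈ S ∧ y ∈ S) k u.1 v.1 →
            Walk (fun x y : S => R x y) k u v := by
        intro k
        induction k with
        | zero => exact fun u v h => Subtype.ext h
        | succ k ih => exact fun u v ⟨w, hw, hwv⟩ => ⟨⟨w, hw.2.2⟩, hw.1, ih _ v hwv⟩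
      obtain ⟨a, ha⟩ := ih (Nat.card S) (by
          rw [← hn, Nat.card_coe_set_eq]
          exact Set.ncard_lt_card hne)
        (R := fun x y : S => R x y) (t := s') (fun x => Subtype.ext (hs x))
        (fun u v h => hsR _ _ h) hp (fun u v => hwalk p u v (hpS u u.2 v v.2))
        (fun i => by
          obtain ⟨x, hx, h⟩ := hS.loc i
          exact ⟨fun j => ⟨x j, hx j⟩, h⟩) rfl
      exact hno ⟨a, ha⟩
    obtain ⟨k, hk⟩ := exists_transitive hmin hid ht hm hall hloc
    have hsub := subsingleton_of_transitive hmin (opPow_idem hid k) (opPow_preserves ht k) hm hall hk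
    obtain ⟨a⟩ := ‹Nonempty A›
    obtain ⟨b, hb⟩ := exists_out hm hall a
    exact hno ⟨a, by rwa [Subsingleton.elim b a] at hb⟩

/-- A finite strongly connected digraph of algebraic length one is primitive. -/
theorem exists_primitive {A : Type*} [Finite A] {G : Digraph A} (hG : StronglyConnected G)
    (hlen : AlgebraicLengthOne G) : Nonempty A ∧ ∃ m, 1 ≤ m ∧ ∀ u v, Walk G.Adj m u v := by
  have hne : Nonempty A := by
    by_contra h
    rw [not_nonempty_iff] at h
    exact (hlen 2 (by norm_num)).false ⟨isEmptyElim, fun {a} => isEmptyElim a⟩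
  obtain ⟨a⟩ := hne
  choose p hp using fun v => exists_walk_of_reflTransGen (hG a v)
  choose q hq using fun v => exists_walk_of_reflTransGen (hG v a)
  let C : AddSubmonoid ℕ :=
    { carrier := {k | Walk G.Adj k a a}
      zero_mem' := rfl
      add_mem' := fun h h' => Walk.append h h' }
  set d := Nat.setGcd (C : Set ℕ) with hd
  have hdvd : ∀ k, Walk G.Adj k a a → d ∣ k := fun k hk => Nat.setGcd_dvd_of_mem hk
  -- Closing walks with `q v` shows that `p v` modulo `e` increases by one along each edge.
  have hhom : ∀ e, e ∣ d → Nonempty (G.Adj →r (directedCycle e).Adj) := by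
    refine fun e he => ⟨⟨fun v => (p v : ZMod e), fun {u v} huv => ?_⟩⟩
    have h1 : e ∣ p u + 1 + q v :=
      he.trans (hdvd _ (((hp u).append (walk_one.2 huv)).append (hq v)))
    have h2 : e ∣ p v + q v := he.trans (hdvd _ ((hp v).append (hq v)))
    rw [← ZMod.natCast_eq_zero_iff] at h1 h2
    push_cast at h1 h2
    change (p v : ZMod e) = p u + 1
    exact add_right_cancel (h2.trans h1.symm)
  have hd1 : d = 1 := by
    rcases Nat.lt_trichotomy d 1 with h | h | h
    -- The case `d = 0` still gives a homomorphism to the 2-cycle, because `2 ∣ 0`.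
    · obtain ⟨f⟩ := hhom 2 (by rw [Nat.lt_one_iff.1 h]; exact dvd_zero 2)
      exact ((hlen 2 (by norm_num)).false f).elim
    · exact h
    · obtain ⟨f⟩ := hhom d dvd_rfl
      exact ((hlen d h).false f).elim
  obtain ⟨n, hn⟩ := Nat.exists_mem_closure_of_ge (C : Set ℕ)
  have hloop : ∀ k, n ≤ k → Walk G.Adj k a a := fun k hk => by
    have := hn k hk (by rw [← hd, hd1]; exact one_dvd k)
    rwa [AddSubmonoid.closure_eq] at this
  obtain ⟨P, hP⟩ := (Set.finite_range p).bddAbove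
  obtain ⟨Q, hQ⟩ := (Set.finite_range q).bddAbove
  refine ⟨⟨a⟩, Q + (n + 1) + P, by omega, fun u v => ?_⟩
  have h1 : p v ≤ P := hP ⟨v, rfl⟩
  have h2 : q u ≤ Q := hQ ⟨u, rfl⟩
  have := ((hq u).append (hloop (Q + (n + 1) + P - q u - p v) (by omega))).append (hp v)
  rwa [show q u + (Q + (n + 1) + P - q u - p v) + p v = Q + (n + 1) + P by omega] at this

theorem exists_common_target {A : Type*} [Finite A] [Nonempty A] {R : A → A → Prop}
    (h : ∀ u v, ∃ w, Relation.TransGen R u w ∧ Relation.TransGen R v w) :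
    ∃ c, ∀ u, Relation.ReflTransGen R u c := by
  classical
  cases nonempty_fintype A
  have key : ∀ s : Finset A, ∃ c, ∀ u ∈ s, Relation.ReflTransGen R u c := by
    intro s
    induction s using Finset.induction_on with
    | empty => exact ⟨Classical.arbitrary A, by simp⟩
    | insert a s _ ih =>
      obtain ⟨c, hc⟩ := ih
      obtain ⟨w, haw, hcw⟩ := h a c
      refine ⟨w, fun u hu => ?_⟩
      rcases Finset.mem_insert.1 hu with rfl | hu
      · exact haw.to_reflTransGen
      · exact (hc u hu).trans hcw.to_reflTransGen
  obtain ⟨c, hc⟩ := key Finset.univ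
  exact ⟨c, fun u => hc u (Finset.mem_univ u)⟩

end LoopLemma

theorem mainTheorem6 {A : Type*} [Finite A] {n : ℕ} (t : (Fin n → A) → A)
    (ht : LoopLemma.IsIdempotentOp t)
    (hP : ∀ (i : Fin n) (u v : A), ∃ w : A,
      (LoopLemma.transClosure (LoopLemma.coordDigraph t i)).Adj u w ∧
      (LoopLemma.transClosure (LoopLemma.coordDigraph t i)).Adj v w)
    (G : Digraph A) (hG : LoopLemma.StronglyConnected G)
    (hcomp : LoopLemma.Compatible G t) (hlen : LoopLemma.AlgebraicLengthOne G) :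
    LoopLemma.HasLoop G := by
  obtain ⟨hne, m, hm, hall⟩ := LoopLemma.exists_primitive hG hlen
  obtain ⟨k, hk, -⟩ := LoopLemma.exists_opPow ht
  refine LoopLemma.exists_loop_of_local (LoopLemma.opPow_idem ht k)
    (LoopLemma.opPow_preserves hcomp k) hm hall fun w => ?_
  obtain ⟨i, hi⟩ := hk w
  obtain ⟨c, hc⟩ := LoopLemma.exists_common_target (R := LoopLemma.CoordRel t i) (hP i)
  -- Every vertex reaches `c`, in particular an in-neighbour of `c` in `G`; this is the shared edge.
  obtain ⟨u, hu⟩ := LoopLemma.exists_in hm hall c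
  obtain ⟨x, rfl, hx⟩ := hi u c (hc u)
  exact ⟨x, by rwa [hx]⟩
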